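/- Let $R$ be a commutative noetherian ring and let $A$ be an associative unital $R$-algebra. Write $A^*=\operatorname{Hom}_R(A,R)$, with left $A$-action $(af)(b)=f(ba)$, and let $$A^\circ=\{f\in A^* : Af \text{ is finitely generated as an } R\text{-module}\},$$ with evaluation pairing $\langle f,a\rangle=f(a)$ for $f\in A^\circ$, $a\in A$. Say that $A$ has property $\mathbf{P}_\ell$ if every left ideal $I$ of $A$ such that $A/I$ is a finitely generated $R$-module contains a left ideal $I_0$ of $A$ such that $A/I_0$ is a finitely generated projective $R$-module. If $C$ is an $R$-coalgebra and $\langle-,-\rangle:C\times A\to R$ is an $R$-bilinear form, then $(C,A,\langle-,-\rangle)$ is called a rational pairing if * for every $R$-module $M$ the map $\alpha_M: M\otimes_R C\to \operatorname{Hom}_R(A,M)$, $m\otimes c\mapsto[a\mapsto \langle c,a\rangle m]$, is injective, and * $a\mapsto\langle -,a\rangle$ is a homomorphism of $R$-algebras from $A$ to the convolution algebra $C^*=\operatorname{Hom}_R(C,R)$, i.e. $\langle c,ab\rangle=\sum\langle c_1,a\rangle\langle c_2,b\rangle$ and $\langle c,1\rangle=\epsilon(c)$ for all $c\in C$ and $a,b\in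 A$. Assume that $A$ has property $\mathbf{P}_\ell$. Then: 1. There is an $R$-coalgebra structure on the $R$-module $A^\circ$ for which $(A^\circ,A,\langle-,-\rangle)$ is a rational pairing; in particular $\sum f_1(a)f_2(b)=f(ab)$ and $\epsilon(f)=f(1)$ for all $f\in A^\circ$ and $a,b\in A$. 2. If moreover $A$ is an $R$-bialgebra, then $A^\circ$, with such a coalgebra structure and with the convolution product $(fg)(a)=\sum f(a_1)g(a_2)$ and unit $\epsilon_A$, is an $R$-bialgebra. 3. If moreover $A$ is a Hopf algebra over $R$ with antipode $S$, then the bialgebra $A^\circ$ of part 2 is a Hopf algebra, with antipode $f\mapsto f\circ S$. -/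

import Mathlib

open scoped TensorProduct

universe u v w

section Pairings

/-- For a bilinear form `B : P × A → R` and an `R`-module `M`, the `R`-linear map
`α_M : M ⊗ P → Hom_R(A, M)`, `m ⊗ p ↦ (a ↦ B(p, a) m)`. -/
def pairingAlpha {R : Type*} [CommRing R] {P A : Type*} [AddCommGroup P] [Module R P]
    [AddCommGroup A] [Module R A] (B : P →ₗ[R] A →ₗ[R] R)
    (M : Type*) [AddCommGroup M] [Module R M] : M ⊗[R] P →ₗ[R] (A →ₗ[R] M) :=
  TensorProduct.lift (LinearMap.mk₂ R (fun m p => (B p).smulRight m)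
    (fun m m' p => by ext a; simp)
    (fun c m p => by ext a; exact smul_comm (B p a) c m)
    (fun m p p' => by ext a; simp [add_smul])
    (fun c m p => by ext a; simp [mul_smul]))

/-- `(P, A, B)` is a rational system: `α_M` is injective for every `R`-module `M`
in the universe `m`. -/
def IsRationalSystem.{r, p, a, m} {R : Type r} [CommRing R] {P : Type p} {A : Type a}
    [AddCommGroup P] [Module R P]
    [AddCommGroup A] [Module R A] (B : P →ₗ[R] A →ₗ[R] R) : Prop :=
  ∀ (M : Type m) [AddCommGroup M] [Module R M], Function.Injective (pairingAlpha B M)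

/-- `(C, A, B)` is a rational pairing: it is a rational system, `C` is an `R`-coalgebra, `A` is an
`R`-algebra, and `a ↦ B(-, a)` is a homomorphism of `R`-algebras from `A` to the convolution
algebra `C^* = Hom_R(C, R)`, whose product is `(f g)(c) = ∑ f(c₁) g(c₂)` and whose unit is the
counit of `C`. -/
structure IsRationalPairing.{r, c, a, m} (R : Type r) [CommRing R] (C : Type c) (A : Type a)
    [AddCommGroup C] [Module R C] [Coalgebra R C] [Ring A] [Algebra R A] (B : C →ₗ[R] A →ₗ[R] R) : Prop where
  rationalSystem : IsRationalSystem.{r, c, a, m} B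
  exists_algHom : ∃ φ : A →ₐ[R] WithConv (C →ₗ[R] R), ∀ (a : A) (c : C), (φ a).ofConv c = B c a

end Pairings

section Mixins

variable (R B : Type*) [CommRing R] [Ring B] [Algebra R B] [Coalgebra R B]

/-- The given algebra and coalgebra structures on `B` form an `R`-bialgebra. -/
structure IsBialgebra : Prop where
  counit_one : Coalgebra.counit (R := R) (1 : B) = 1
  counit_mul : ∀ a b : B, Coalgebra.counit (R := R) (a * b) =
    Coalgebra.counit (R := R) a * Coalgebra.counit (R := R) b
  comul_one : Coalgebra.comul (R := R) (1 : B) = 1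
  comul_mul : ∀ a b : B, Coalgebra.comul (R := R) (a * b) =
    Coalgebra.comul (R := R) a * Coalgebra.comul (R := R) b

variable {R B}

/-- The Mathlib bialgebra with the given algebra and coalgebra structures. -/
abbrev IsBialgebra.toBialgebra (h : IsBialgebra R B) : Bialgebra R B :=
  Bialgebra.mk' R B h.counit_one (fun {a b} => h.counit_mul a b) h.comul_one
    (fun {a b} => h.comul_mul a b)

/-- `S` is an antipode for the given algebra and coalgebra structures on `B`:
`∑ S(b₁) b₂ = ε(b) 1 = ∑ b₁ S(b₂)`. -/
structure IsAntipode (S : B →ₗ[R] B) : Prop where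
  mul_antipode_rTensor_comul : LinearMap.mul' R B ∘ₗ S.rTensor B ∘ₗ Coalgebra.comul =
    Algebra.linearMap R B ∘ₗ Coalgebra.counit
  mul_antipode_lTensor_comul : LinearMap.mul' R B ∘ₗ S.lTensor B ∘ₗ Coalgebra.comul =
    Algebra.linearMap R B ∘ₗ Coalgebra.counit

/-- The Mathlib Hopf algebra with the given algebra and coalgebra structures and antipode `S`. -/
abbrev IsAntipode.toHopfAlgebra {S : B →ₗ[R] B} (hS : IsAntipode S) (h : IsBialgebra R B) :
    HopfAlgebra R B :=
  { h.toBialgebra with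
    antipode := S
    mul_antipode_rTensor_comul := hS.mul_antipode_rTensor_comul
    mul_antipode_lTensor_comul := hS.mul_antipode_lTensor_comul }

end Mixins

section FiniteDual

/-- Property `P_ℓ`: every left ideal `I` of `A` with `A/I` finitely generated over `R` contains a
left ideal `I₀` with `A/I₀` finitely generated and projective over `R`. -/
def PropertyPl (R A : Type*) [CommRing R] [Ring A] [Algebra R A] : Prop :=
  ∀ I : Submodule A A, Module.Finite R (A ⧸ I) →
    ∃ I₀ : Submodule A A, I₀ ≤ I ∧ Module.Finite R (A ⧸ I₀) ∧ Module.Projective R (A ⧸ I₀)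

/-- The `R`-linear map `A → A^*`, `a ↦ a f`, where `(a f)(b) = f(b a)`; its range is `A f`. -/
def dualOrbit {R A : Type*} [CommRing R] [Ring A] [Algebra R A] (f : Module.Dual R A) :
    A →ₗ[R] Module.Dual R A :=
  (LinearMap.mul R A).flip.compr₂ f

@[simp] theorem dualOrbit_apply {R A : Type*} [CommRing R] [Ring A] [Algebra R A]
    (f : Module.Dual R A) (a b : A) : dualOrbit f a b = f (b * a) := rfl

variable (R A : Type*) [CommRing R] [IsNoetherianRing R] [Ring A]

/-- The finite dual `A° = {f ∈ A^* | A f is finitely generated over R}`. -/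
def finiteDual [Algebra R A] : Submodule R (Module.Dual R A) where
  carrier := {f | (LinearMap.range (dualOrbit f)).FG}
  zero_mem' := by
    have : dualOrbit (0 : Module.Dual R A) = 0 := by ext; simp
    simp [this, Submodule.fg_bot]
  add_mem' := by
    intro f g hf hg
    refine Submodule.FG.of_le (Submodule.FG.sup hf hg) ?_
    rintro _ ⟨a, rfl⟩
    have : dualOrbit (f + g) a = dualOrbit f a + dualOrbit g a := by ext; simp
    rw [this]
    exact Submodule.add_mem_sup ⟨a, rfl⟩ ⟨a, rfl⟩
  smul_mem' := by
    intro c f hf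
    refine Submodule.FG.of_le hf ?_
    rintro _ ⟨a, rfl⟩
    have : dualOrbit (c • f) a = dualOrbit f (c • a) := by ext; simp
    rw [this]
    exact ⟨_, rfl⟩

/-- The evaluation pairing `⟨f, a⟩ = f(a)` between `A°` and `A`. -/
def evalPairing [Algebra R A] : finiteDual R A →ₗ[R] A →ₗ[R] R :=
  (finiteDual R A).subtype

end FiniteDual

section ConvolutionAlgebra

variable {R A : Type*} [CommRing R] [IsNoetherianRing R] [Ring A] [Bialgebra R A]

/-- The convolution product `(f g)(a) = ∑ f(a₁) g(a₂)` of `A^*` as a bilinear map. -/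
noncomputable def dualConv : Module.Dual R A →ₗ[R] Module.Dual R A →ₗ[R] Module.Dual R A :=
  LinearMap.mk₂ R (fun f g => (WithConv.toConv f * WithConv.toConv g).ofConv)
    (fun f f' g => by simp [add_mul])
    (fun c f g => by rw [WithConv.toConv_smul, smul_mul_assoc, WithConv.ofConv_smul])
    (fun f g g' => by simp [mul_add])
    (fun c f g => by rw [WithConv.toConv_smul, mul_smul_comm, WithConv.ofConv_smul])

theorem dualConv_mem {f g : Module.Dual R A} (hf : f ∈ finiteDual R A)
    (hg : g ∈ finiteDual R A) : dualConv f g ∈ finiteDual R A := by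
  have key : dualOrbit (dualConv f g) = TensorProduct.lift (dualConv (R := R) (A := A)) ∘ₗ
      TensorProduct.map (dualOrbit f) (dualOrbit g) ∘ₗ Coalgebra.comul := by
    ext a b
    have h : dualOrbit (dualConv f g) a b = LinearMap.mul' R R
        (TensorProduct.map f g (Coalgebra.comul (R := R) b * Coalgebra.comul (R := R) a)) := by
      rw [← Bialgebra.comul_mul]
      rfl
    rw [h]
    change _ = TensorProduct.lift (dualConv (R := R) (A := A))
      (TensorProduct.map (dualOrbit f) (dualOrbit g) (Coalgebra.comul (R := R) a)) b
    generalize Coalgebra.comul (R := R) a = x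
    induction x with
    | zero => simp
    | add x y hx hy => simp only [mul_add, map_add, LinearMap.add_apply, hx, hy]
    | tmul x y =>
      rw [TensorProduct.map_tmul, TensorProduct.lift.tmul]
      change _ = LinearMap.mul' R R
        (TensorProduct.map (dualOrbit f x) (dualOrbit g y) (Coalgebra.comul (R := R) b))
      generalize Coalgebra.comul (R := R) b = z
      induction z with
      | zero => simp
      | add z t hz ht => simp only [add_mul, map_add, hz, ht]
      | tmul z t => simp
  refine Submodule.FG.of_le (Submodule.FG.map₂ dualConv hf hg) ?_
  rintro _ ⟨a, rfl⟩
  rw [key]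
  change TensorProduct.lift (dualConv (R := R) (A := A))
    (TensorProduct.map (dualOrbit f) (dualOrbit g) (Coalgebra.comul (R := R) a)) ∈ _
  generalize Coalgebra.comul (R := R) a = x
  induction x with
  | zero => simp
  | add x y hx hy => simpa only [map_add] using add_mem hx hy
  | tmul x y => exact Submodule.apply_mem_map₂ _ ⟨x, rfl⟩ ⟨y, rfl⟩

theorem dualCounit_mem : (Coalgebra.counit : Module.Dual R A) ∈ finiteDual R A := by
  refine Submodule.FG.of_le
    (Submodule.fg_span_singleton (Coalgebra.counit : Module.Dual R A)) ?_
  rintro _ ⟨a, rfl⟩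
  refine Submodule.mem_span_singleton.2 ⟨Coalgebra.counit (R := R) a, ?_⟩
  ext b
  simp [mul_comm]

/-- The ring structure on `A°` for a bialgebra `A`: the product is convolution,
the unit is the counit of `A`. -/
noncomputable instance finiteDualRing : Ring (finiteDual R A) :=
  { (inferInstance : AddCommGroup (finiteDual R A)) with
    mul := fun f g => ⟨dualConv f.1 g.1, dualConv_mem f.2 g.2⟩
    one := ⟨Coalgebra.counit, dualCounit_mem⟩
    mul_assoc := fun f g h => Subtype.ext <| congrArg WithConv.ofConv
      (mul_assoc (WithConv.toConv f.1) (WithConv.toConv g.1) (WithConv.toConv h.1))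
    one_mul := fun f => Subtype.ext <| congrArg WithConv.ofConv (one_mul (WithConv.toConv f.1))
    mul_one := fun f => Subtype.ext <| congrArg WithConv.ofConv (mul_one (WithConv.toConv f.1))
    left_distrib := fun f g h => Subtype.ext (map_add (dualConv f.1) g.1 h.1)
    right_distrib := fun f g h => Subtype.ext (LinearMap.map_add₂ dualConv f.1 g.1 h.1)
    zero_mul := fun f => Subtype.ext (LinearMap.map_zero₂ dualConv f.1)
    mul_zero := fun f => Subtype.ext (map_zero (dualConv f.1)) }

/-- The `R`-algebra structure on `A°`; its scalar action is that of the submodule `A° ⊆ A^*`. -/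
noncomputable instance finiteDualAlgebra : Algebra R (finiteDual R A) :=
  Algebra.ofModule
    (fun c f g => Subtype.ext (LinearMap.map_smul₂ dualConv c f.1 g.1))
    (fun c f g => Subtype.ext (map_smul (dualConv f.1) c g.1))

end ConvolutionAlgebra

/-! ### Dual bases in `A°` and rationality of the evaluation pairing -/

section DualBasis

variable {R A : Type*} [CommRing R] [IsNoetherianRing R] [Ring A] [Algebra R A]

/-! Finitely many `f_j` in `A°` are all killed by one left ideal of finite colength, since `A`
modulo their annihilator embeds in the product of the finitely generated modules `A f_j` and `R` is
noetherian. By `P_ℓ` it contains a left ideal `I₀` with `A/I₀` finitely generated projective. A dual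
basis of `A/I₀` lifts to `x_i` in `A` and `φ_i` in `A°` with `f_j(ab) = ∑ f_j(a x_i) φ_i(b)`
(`PropertyPl.exists_dual_basis`).

This formula carries everything special to `A°`. At `a = 1` it expands all `f_j` in the same `φ_i`,
which makes `α_M` injective; for one `f` it gives `Δ f = ∑ x_i f ⊗ φ_i`; with antipodes inserted it
keeps `f ∘ S` in `A°`.

The rest is formal duality: iterating rationality embeds `C ⊗ C` and `C ⊗ C ⊗ C` into multilinear
forms on `A`, so each coalgebra, bialgebra or antipode axiom may be tested on elements of `A`, where
it is the dual axiom. -/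

/-- The left ideal of all `a` with `a f = 0` for every member `f` of a family in `A^*`. -/
def dualAnnihilator {ι : Type*} (f : ι → Module.Dual R A) : Submodule A A where
  carrier := {a | ∀ j, dualOrbit (f j) a = 0}
  zero_mem' := fun j => map_zero _
  add_mem' := fun ha hb j => by rw [map_add, ha j, hb j, add_zero]
  smul_mem' := fun c a ha j => by
    ext b
    simpa [mul_assoc] using LinearMap.congr_fun (ha j) (b * c)

theorem finite_quotient_ker_pi {R M ι : Type*} [CommRing R] [IsNoetherianRing R] [AddCommGroup M]
    [Module R M] [Finite ι] {N : ι → Type*} [∀ j, AddCommGroup (N j)] [∀ j, Module R (N j)]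
    (φ : ∀ j, M →ₗ[R] N j) (hφ : ∀ j, (LinearMap.range (φ j)).FG) :
    Module.Finite R (M ⧸ ⨅ j, LinearMap.ker (φ j)) := by
  have (j : ι) : Module.Finite R (M ⧸ LinearMap.ker (φ j)) :=
    have := Module.Finite.iff_fg.2 (hφ j)
    Module.Finite.equiv (φ j).quotKerEquivRange.symm
  have hker : LinearMap.ker (LinearMap.pi fun j => (LinearMap.ker (φ j)).mkQ) =
      ⨅ j, LinearMap.ker (φ j) := by
    simp [LinearMap.ker_pi]
  rw [← hker]
  exact Module.Finite.of_injective _ (LinearMap.ker_eq_bot.1 (Submodule.ker_liftQ_eq_bot' _ _ rfl))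

theorem finite_quotient_dualAnnihilator {ι : Type*} [Finite ι] (f : ι → finiteDual R A) :
    Module.Finite R (A ⧸ dualAnnihilator fun j => (f j : Module.Dual R A)) := by
  let I := dualAnnihilator fun j => (f j : Module.Dual R A)
  have hI : ⨅ j, LinearMap.ker (dualOrbit (f j : Module.Dual R A)) = I.restrictScalars R := by
    ext a
    simp only [Submodule.mem_iInf, LinearMap.mem_ker]
    rfl
  have hfin := finite_quotient_ker_pi (fun j => dualOrbit (f j : Module.Dual R A)) fun j => (f j).2
  rw [hI] at hfin
  exact Module.Finite.equiv (Submodule.Quotient.restrictScalarsEquiv R I)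

/-- As `I` is a left ideal, `a ∈ I` forces `f(ba) = 0` for all `b`, so `a ↦ a f` factors through
`A/I`. -/
theorem mem_finiteDual_of_forall_mem {I : Submodule A A} [Module.Finite R (A ⧸ I)]
    {f : Module.Dual R A} (hf : ∀ a ∈ I, f a = 0) : f ∈ finiteDual R A := by
  have hle : I.restrictScalars R ≤ LinearMap.ker (dualOrbit f) := fun a ha => by
    ext b
    exact hf _ (I.smul_mem b ha)
  have : Module.Finite R (A ⧸ I.restrictScalars R) :=
    Module.Finite.equiv (Submodule.Quotient.restrictScalarsEquiv R I).symm
  change (LinearMap.range (dualOrbit f)).FG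
  rw [← Submodule.range_liftQ _ _ hle]
  exact Module.Finite.iff_fg.1 inferInstance

/-- Under `P_ℓ`, finitely many elements of `A°` have a common dual basis in `A` and `A°`. -/
theorem PropertyPl.exists_dual_basis (h : PropertyPl R A) {ι : Type*} [Finite ι]
    (f : ι → finiteDual R A) :
    ∃ (n : ℕ) (x : Fin n → A) (φ : Fin n → finiteDual R A), ∀ (j : ι) (a b : A),
      (f j : Module.Dual R A) (a * b) =
        ∑ i, (f j : Module.Dual R A) (a * x i) * (φ i : Module.Dual R A) b := by
  obtain ⟨I, hI, _, _⟩ := h _ (finite_quotient_dualAnnihilator f)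
  obtain ⟨n, p, g, -, -, hpg⟩ := Module.Finite.exists_comp_eq_id_of_projective R (A ⧸ I)
  choose x hx using fun i => I.mkQ_surjective (p (Pi.single i 1))
  let φ (i : Fin n) : Module.Dual R A :=
    LinearMap.proj i ∘ₗ g ∘ₗ I.mkQ.restrictScalars R
  have hφ (i : Fin n) : φ i ∈ finiteDual R A :=
    mem_finiteDual_of_forall_mem (I := I) fun a ha => by
      have : I.mkQ a = 0 := (Submodule.Quotient.mk_eq_zero I).2 ha
      simp [φ, this]
  refine ⟨n, x, fun i => ⟨φ i, hφ i⟩, fun j a b => ?_⟩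
  -- Modulo `I` this is the identity `p ∘ g = id`.
  have hb : b - ∑ i, φ i b • x i ∈ I := by
    rw [← Submodule.Quotient.mk_eq_zero, ← Submodule.mkQ_apply, map_sub, sub_eq_zero, map_sum]
    have h1 : I.mkQ b = p (g (I.mkQ b)) := (LinearMap.congr_fun hpg _).symm
    rw [h1, pi_eq_sum_univ' (g (I.mkQ b)), map_sum]
    refine Finset.sum_congr rfl fun i _ => ?_
    have h2 : I.mkQ (φ i b • x i) = φ i b • I.mkQ (x i) :=
      (I.mkQ.restrictScalars R).map_smul _ _
    rw [h2, hx, map_smul]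
    simp only [φ, LinearMap.comp_apply, LinearMap.proj_apply, LinearMap.coe_restrictScalars]
  -- `I` lies in the annihilator of the family, so `f j` vanishes on `a * I`.
  have h0 : (f j : Module.Dual R A) (a * (b - ∑ i, φ i b • x i)) = 0 :=
    LinearMap.congr_fun (hI hb j) a
  rw [mul_sub, map_sub, sub_eq_zero] at h0
  rw [h0, Finset.mul_sum, map_sum]
  simp [mul_comm]

theorem dualOrbit_mem {f : Module.Dual R A} (hf : f ∈ finiteDual R A) (x : A) :
    dualOrbit f x ∈ finiteDual R A := by
  refine Submodule.FG.of_le hf ?_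
  rintro _ ⟨a, rfl⟩
  refine ⟨a * x, ?_⟩
  ext b
  simp [mul_assoc]

/-- Expanding the second factors in a common dual basis rewrites `z` as `∑ α_M(z)(x_i) ⊗ φ_i`. -/
theorem PropertyPl.isRationalSystem (h : PropertyPl R A) :
    IsRationalSystem (P := finiteDual R A) (evalPairing R A) := by
  intro M _ _
  rw [injective_iff_map_eq_zero]
  intro z hz
  obtain ⟨S, rfl⟩ := TensorProduct.exists_finset z
  obtain ⟨n, x, φ, hφ⟩ := h.exists_dual_basis fun p : S => p.1.2
  have key (p : S) : p.1.2 = ∑ i, (p.1.2 : Module.Dual R A) (x i) • φ i := by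
    ext b
    simpa using hφ p 1 b
  have hz' (a : A) : ∑ p ∈ S, (p.2 : Module.Dual R A) a • p.1 = 0 := by
    simpa [pairingAlpha, evalPairing] using LinearMap.congr_fun hz a
  calc ∑ p ∈ S, p.1 ⊗ₜ[R] p.2
      = ∑ p ∈ S, ∑ i, ((p.2 : Module.Dual R A) (x i) • p.1) ⊗ₜ[R] φ i := by
        refine Finset.sum_congr rfl fun p hp => ?_
        conv_lhs => rw [key ⟨p, hp⟩]
        simp [TensorProduct.tmul_sum, TensorProduct.smul_tmul]
    _ = 0 := by
        rw [Finset.sum_comm]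
        simp_rw [← TensorProduct.sum_tmul, hz', TensorProduct.zero_tmul, Finset.sum_const_zero]

end DualBasis
-- Tensor powers of `C` as multilinear forms on `A`
section RationalSystem

variable {R A C : Type*} [CommRing R] [Ring A] [Algebra R A] [AddCommGroup C] [Module R C]
  (B : C →ₗ[R] A →ₗ[R] R)

/-- The map `C ⊗ C → Bil(A, A; R)`, `f ⊗ g ↦ ((a, b) ↦ B(f, a) B(g, b))`. -/
noncomputable def tensorPairing : C ⊗[R] C →ₗ[R] A →ₗ[R] A →ₗ[R] R :=
  TensorProduct.lift (LinearMap.mk₂ R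
    (fun f g => (LinearMap.mul R R).compl₁₂ (B f) (B g))
    (fun f f' g => by ext; simp)
    (fun c f g => by ext; simp [mul_assoc])
    (fun f g g' => by ext; simp [mul_add])
    (fun c f g => by ext; simp [mul_left_comm]))

@[simp] theorem tensorPairing_tmul (f g : C) (a b : A) :
    tensorPairing B (f ⊗ₜ g) a b = B f a * B g b := rfl

/-- Factors the pairing of `C ⊗ C` through `α_C`, so that its injectivity follows from rationality
at `M = C`. -/
theorem tensorPairing_eq_pairingAlpha (z : C ⊗[R] C) (a b : A) :
    tensorPairing B z a b = B (pairingAlpha B C z b) a := by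
  induction z with
  | zero => simp
  | add z w hz hw => simp [hz, hw]
  | tmul f g => simp [pairingAlpha, mul_comm]

/-- The map `(C ⊗ C) ⊗ C → Hom(A, Bil(A, A; R))` that evaluates the last factor first. -/
noncomputable def tensorPairing₃ : (C ⊗[R] C) ⊗[R] C →ₗ[R] A →ₗ[R] A →ₗ[R] A →ₗ[R] R :=
  (LinearMap.llcomp R A _ _ (tensorPairing B)) ∘ₗ pairingAlpha B (C ⊗[R] C)

@[simp] theorem tensorPairing₃_tmul (z : C ⊗[R] C) (f : C) (a b c : A) :
    tensorPairing₃ B (z ⊗ₜ f) c a b = B f c * tensorPairing B z a b := by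
  simp [tensorPairing₃, pairingAlpha]

theorem tensorPairing₃_rTensor {Δ : C →ₗ[R] C ⊗[R] C}
    (hΔ : ∀ f a b, tensorPairing B (Δ f) a b = B f (a * b)) (z : C ⊗[R] C) (a b c : A) :
    tensorPairing₃ B (Δ.rTensor C z) c a b = tensorPairing B z (a * b) c := by
  induction z with
  | zero => simp
  | add z w hz hw => simp [hz, hw]
  | tmul f g => simp [hΔ, mul_comm]

theorem tensorPairing₃_lTensor {Δ : C →ₗ[R] C ⊗[R] C}
    (hΔ : ∀ f a b, tensorPairing B (Δ f) a b = B f (a * b)) (z : C ⊗[R] C) (a b c : A) :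
    tensorPairing₃ B ((TensorProduct.assoc R C C C).symm (Δ.lTensor C z)) c a b =
      tensorPairing B z a (b * c) := by
  induction z with
  | zero => simp
  | add z w hz hw => simp [hz, hw]
  | tmul f g =>
    rw [LinearMap.lTensor_tmul, tensorPairing_tmul, ← hΔ g]
    generalize Δ g = y
    induction y with
    | zero => simp
    | add y y' hy hy' =>
      simp only [TensorProduct.tmul_add, map_add, LinearMap.add_apply, hy, hy', mul_add]
    | tmul p q => simp [mul_left_comm, mul_comm]

/-- The counit `f ↦ B(f, 1)`. -/
def pairingCounit : C →ₗ[R] R :=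
  B.flip 1

@[simp] theorem pairingCounit_apply (f : C) : pairingCounit B f = B f 1 := rfl

theorem pairing_lid_rTensor_pairingCounit (z : C ⊗[R] C) (a : A) :
    B (TensorProduct.lid R C ((pairingCounit B).rTensor C z)) a = tensorPairing B z 1 a := by
  induction z with
  | zero => simp
  | add z w hz hw => simp [hz, hw]
  | tmul f g => simp

theorem pairing_rid_lTensor_pairingCounit (z : C ⊗[R] C) (a : A) :
    B (TensorProduct.rid R C ((pairingCounit B).lTensor C z)) a = tensorPairing B z a 1 := by
  induction z with
  | zero => simp
  | add z w hz hw => simp [hz, hw]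
  | tmul f g => simp [mul_comm]

end RationalSystem

/-! ### The coalgebra dual to the product of `A` -/

section RationalCoalgebra

variable {R : Type u} {A : Type v} {C : Type w} [CommRing R] [Ring A] [Algebra R A]
  [AddCommGroup C] [Module R C] {B : C →ₗ[R] A →ₗ[R] R}

theorem IsRationalSystem.tensorPairing_injective (h : IsRationalSystem.{u, w, v, w} B)
    (hB : Function.Injective B) : Function.Injective (tensorPairing B) := by
  intro z w hzw
  refine h _ (LinearMap.ext fun b => hB (LinearMap.ext fun a => ?_))
  rw [← tensorPairing_eq_pairingAlpha, ← tensorPairing_eq_pairingAlpha, hzw]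

/-- Rationality at `M = C ⊗ C` reduces three factors to two. -/
theorem IsRationalSystem.tensorPairing₃_injective (h : IsRationalSystem.{u, w, v, w} B)
    (hB : Function.Injective B) : Function.Injective (tensorPairing₃ B) := fun _ _ hzw =>
  h _ (LinearMap.ext fun c => h.tensorPairing_injective hB (LinearMap.congr_fun hzw c))

/-- In a rational system with a pointwise comultiplication dual to the product of `A`, there is a
linear one. -/
theorem IsRationalSystem.exists_comul (h : IsRationalSystem.{u, w, v, w} B)
    (hB : Function.Injective B)
    (hΔ : ∀ f, ∃ (n : ℕ) (g φ : Fin n → C), ∀ a b, B f (a * b) = ∑ i, B (g i) a * B (φ i) b) :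
    ∃ Δ : C →ₗ[R] C ⊗[R] C, ∀ f a b, tensorPairing B (Δ f) a b = B f (a * b) := by
  have hex (f : C) : ∃ z, ∀ a b, tensorPairing B z a b = B f (a * b) := by
    obtain ⟨n, g, φ, hφ⟩ := hΔ f
    exact ⟨∑ i, g i ⊗ₜ φ i, fun a b => by simp [hφ]⟩
  choose Δ hΔ using hex
  -- `Δ f` is determined by its pairings, so the pointwise choice is automatically linear.
  refine ⟨⟨⟨Δ, fun f g => ?_⟩, fun c f => ?_⟩, hΔ⟩ <;>
  · apply h.tensorPairing_injective hB
    ext a b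
    simp [hΔ]

/-- The coalgebra structure on `C` whose comultiplication is dual to the product of `A`. -/
noncomputable abbrev IsRationalSystem.coalgebra (h : IsRationalSystem.{u, w, v, w} B)
    (hB : Function.Injective B) (Δ : C →ₗ[R] C ⊗[R] C)
    (hΔ : ∀ f a b, tensorPairing B (Δ f) a b = B f (a * b)) : Coalgebra R C where
  comul := Δ
  counit := pairingCounit B
  coassoc := LinearMap.ext fun f => (TensorProduct.assoc R C C C).symm.injective <|
    h.tensorPairing₃_injective hB <| by
      ext c a b
      simp only [LinearMap.comp_apply, LinearEquiv.coe_coe, LinearEquiv.symm_apply_apply]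
      rw [tensorPairing₃_rTensor B hΔ, tensorPairing₃_lTensor B hΔ, hΔ, hΔ, mul_assoc]
  rTensor_counit_comp_comul := LinearMap.ext fun f =>
    (TensorProduct.lid R C).injective <| hB <| by
      ext a
      rw [LinearMap.comp_apply, pairing_lid_rTensor_pairingCounit]
      simp [hΔ]
  lTensor_counit_comp_comul := LinearMap.ext fun f =>
    (TensorProduct.rid R C).injective <| hB <| by
      ext a
      rw [LinearMap.comp_apply, pairing_rid_lTensor_pairingCounit]
      simp [hΔ]

end RationalCoalgebra

/-! ### Convolution and bialgebra axioms by duality -/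

section PairingDuality

variable {R A C : Type*} [CommRing R] [Ring A]

theorem exists_algHom_of_tensorPairing [Algebra R A] [AddCommGroup C] [Module R C] [Coalgebra R C]
    {B : C →ₗ[R] A →ₗ[R] R}
    (hε : ∀ f, Coalgebra.counit (R := R) f = B f 1)
    (hΔ : ∀ f a b, tensorPairing B (Coalgebra.comul f) a b = B f (a * b)) :
    ∃ φ : A →ₐ[R] WithConv (C →ₗ[R] R), ∀ (a : A) (c : C), (φ a).ofConv c = B c a := by
  refine ⟨AlgHom.ofLinearMap
    ((WithConv.linearEquiv R (C →ₗ[R] R)).symm.toLinearMap ∘ₗ B.flip) ?_ ?_, fun a c => rfl⟩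
  · ext f
    exact (hε f).symm
  · intro a b
    ext f
    have key (z : C ⊗[R] C) : tensorPairing B z a b =
        LinearMap.mul' R R (TensorProduct.map (B.flip a) (B.flip b) z) := by
      induction z with
      | zero => simp
      | add z w hz hw => simp [hz, hw]
      | tmul f g => simp
    exact (hΔ f a b).symm.trans (key _)

variable [Bialgebra R A] [Ring C] [Algebra R C] {B : C →ₗ[R] A →ₗ[R] R}

/-- The product of `C ⊗ C` is dual to the comultiplication of `A ⊗ A`; this serves to test
multiplicativity of `Δ`. -/
theorem tensorPairing_mul
    (hmul : ∀ f g a, B (f * g) a =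
      LinearMap.mul' R R (TensorProduct.map (B f) (B g) (Coalgebra.comul a)))
    {ι κ : Type*} (z w : C ⊗[R] C) {a b : A} (s : Coalgebra.Repr R a ι) (t : Coalgebra.Repr R b κ) :
    tensorPairing B (z * w) a b = ∑ i ∈ s.index, ∑ j ∈ t.index,
      tensorPairing B z (s.left i) (t.left j) * tensorPairing B w (s.right i) (t.right j) := by
  induction z with
  | zero => simp
  | add z z' hz hz' => simp [add_mul, hz, hz', Finset.sum_add_distrib]
  | tmul p q =>
    induction w with
    | zero => simp
    | add w w' hw hw' => simp [mul_add, hw, hw', Finset.sum_add_distrib]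
    | tmul p' q' =>
      simp [hmul, ← s.eq, ← t.eq, Finset.sum_mul_sum, mul_mul_mul_comm]

theorem isBialgebra_of_tensorPairing [Coalgebra R C]
    (hinj : Function.Injective (tensorPairing B))
    (hε : ∀ f, Coalgebra.counit (R := R) f = B f 1)
    (hΔ : ∀ f a b, tensorPairing B (Coalgebra.comul f) a b = B f (a * b))
    (hone : ∀ a, B 1 a = Coalgebra.counit (R := R) a)
    (hmul : ∀ f g a, B (f * g) a =
      LinearMap.mul' R R (TensorProduct.map (B f) (B g) (Coalgebra.comul a))) :
    IsBialgebra R C where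
  counit_one := by simp [hε, hone]
  counit_mul f g := by simp [hε, hmul, Algebra.TensorProduct.one_def]
  comul_one := hinj <| by
    ext a b
    simp [hΔ, hone, Algebra.TensorProduct.one_def]
  comul_mul f g := hinj <| by
    ext a b
    rw [tensorPairing_mul hmul _ _ (Coalgebra.Repr.arbitrary R a) (Coalgebra.Repr.arbitrary R b),
      hΔ, hmul, Bialgebra.comul_mul]
    conv_lhs => rw [← (Coalgebra.Repr.arbitrary R a).eq, ← (Coalgebra.Repr.arbitrary R b).eq]
    simp [hΔ, Finset.sum_mul_sum]

end PairingDuality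

/-! ### The antipode axiom by duality -/

section PairingAntipode

variable {R A C : Type*} [CommRing R] [Ring A] [HopfAlgebra R A] [Ring C] [Algebra R C]
  {B : C →ₗ[R] A →ₗ[R] R}

theorem pairing_mul_rTensor
    (hmul : ∀ f g a, B (f * g) a =
      LinearMap.mul' R R (TensorProduct.map (B f) (B g) (Coalgebra.comul a)))
    {S : C →ₗ[R] C} (hS : ∀ f a, B (S f) a = B f (HopfAlgebra.antipode R a))
    {ι : Type*} (z : C ⊗[R] C) {a : A} (s : Coalgebra.Repr R a ι) :
    B (LinearMap.mul' R C (S.rTensor C z)) a =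
      ∑ i ∈ s.index, tensorPairing B z (HopfAlgebra.antipode R (s.left i)) (s.right i) := by
  induction z with
  | zero => simp
  | add z w hz hw => simp [hz, hw, Finset.sum_add_distrib]
  | tmul f g => simp [hmul, hS, ← s.eq]

theorem pairing_mul_lTensor
    (hmul : ∀ f g a, B (f * g) a =
      LinearMap.mul' R R (TensorProduct.map (B f) (B g) (Coalgebra.comul a)))
    {S : C →ₗ[R] C} (hS : ∀ f a, B (S f) a = B f (HopfAlgebra.antipode R a))
    {ι : Type*} (z : C ⊗[R] C) {a : A} (s : Coalgebra.Repr R a ι) :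
    B (LinearMap.mul' R C (S.lTensor C z)) a =
      ∑ i ∈ s.index, tensorPairing B z (s.left i) (HopfAlgebra.antipode R (s.right i)) := by
  induction z with
  | zero => simp
  | add z w hz hw => simp [hz, hw, Finset.sum_add_distrib]
  | tmul f g => simp [hmul, hS, ← s.eq]

theorem isAntipode_of_tensorPairing [Coalgebra R C] (hB : Function.Injective B)
    (hε : ∀ f, Coalgebra.counit (R := R) f = B f 1)
    (hΔ : ∀ f a b, tensorPairing B (Coalgebra.comul f) a b = B f (a * b))
    (hone : ∀ a, B 1 a = Coalgebra.counit (R := R) a)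
    (hmul : ∀ f g a, B (f * g) a =
      LinearMap.mul' R R (TensorProduct.map (B f) (B g) (Coalgebra.comul a)))
    {S : C →ₗ[R] C} (hS : ∀ f a, B (S f) a = B f (HopfAlgebra.antipode R a)) :
    IsAntipode S where
  mul_antipode_rTensor_comul := LinearMap.ext fun f => hB <| by
    ext a
    have := pairing_mul_rTensor hmul hS (Coalgebra.comul f) (Coalgebra.Repr.arbitrary R a)
    simp only [LinearMap.comp_apply]
    rw [this]
    simp only [hΔ, ← map_sum, HopfAlgebra.sum_antipode_mul_eq_smul]
    simp [hε, hone, Algebra.algebraMap_eq_smul_one, mul_comm]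
  mul_antipode_lTensor_comul := LinearMap.ext fun f => hB <| by
    ext a
    have := pairing_mul_lTensor hmul hS (Coalgebra.comul f) (Coalgebra.Repr.arbitrary R a)
    simp only [LinearMap.comp_apply]
    rw [this]
    simp only [hΔ, ← map_sum, HopfAlgebra.sum_mul_antipode_eq_smul]
    simp [hε, hone, Algebra.algebraMap_eq_smul_one, mul_comm]

end PairingAntipode
-- The structures on `A°`
section FiniteDualCoalgebra

theorem evalPairing_injective (R A : Type*) [CommRing R] [IsNoetherianRing R] [Ring A]
    [Algebra R A] : Function.Injective (evalPairing R A) :=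
  (finiteDual R A).injective_subtype

variable {R : Type u} {A : Type v} [CommRing R] [IsNoetherianRing R] [Ring A]

theorem PropertyPl.exists_comul [Algebra R A] (h : PropertyPl R A) :
    ∃ Δ : finiteDual R A →ₗ[R] finiteDual R A ⊗[R] finiteDual R A,
      ∀ f a b, tensorPairing (C := finiteDual R A) (evalPairing R A) (Δ f) a b =
        evalPairing R A f (a * b) := by
  refine h.isRationalSystem.exists_comul (evalPairing_injective R A) fun f => ?_
  obtain ⟨n, x, φ, hφ⟩ := h.exists_dual_basis fun _ : Unit => f
  let g (i : Fin n) : finiteDual R A :=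
    ⟨dualOrbit (f : Module.Dual R A) (x i), dualOrbit_mem f.2 (x i)⟩
  exact ⟨n, g, φ, hφ ()⟩

/-- The coalgebra structure on `A°` for an algebra `A` with `P_ℓ`. -/
noncomputable abbrev PropertyPl.coalgebra [Algebra R A] (h : PropertyPl R A) :
    Coalgebra R (finiteDual R A) :=
  h.isRationalSystem.coalgebra (evalPairing_injective R A) h.exists_comul.choose
    h.exists_comul.choose_spec

theorem PropertyPl.isRationalPairing [Algebra R A] (h : PropertyPl R A) :
    letI := h.coalgebra
    IsRationalPairing.{u, max u v, v, w} R (finiteDual R A) A (evalPairing R A) :=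
  letI := h.coalgebra
  ⟨h.isRationalSystem, exists_algHom_of_tensorPairing (C := finiteDual R A) (fun _ => rfl)
    h.exists_comul.choose_spec⟩

theorem PropertyPl.isBialgebra_finiteDual [Bialgebra R A] (h : PropertyPl R A) :
    letI := h.coalgebra
    IsBialgebra R (finiteDual R A) :=
  letI := h.coalgebra
  isBialgebra_of_tensorPairing (C := finiteDual R A) (B := evalPairing R A)
    (h.isRationalSystem.tensorPairing_injective (evalPairing_injective R A))
    (fun _ => rfl) h.exists_comul.choose_spec (fun _ => rfl) (fun _ _ _ => rfl)

/-- Since `S` reverses products, `(a(f ∘ S))(b) = f(S(a) S(b))`; the dual basis formula puts `A(f ∘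
S)` in the span of the finitely many `φ_i ∘ S`. -/
theorem PropertyPl.comp_antipode_mem [HopfAlgebra R A] (h : PropertyPl R A)
    {f : Module.Dual R A} (hf : f ∈ finiteDual R A) :
    f ∘ₗ HopfAlgebra.antipode R ∈ finiteDual R A := by
  obtain ⟨n, x, φ, hφ⟩ := h.exists_dual_basis fun _ : Unit => (⟨f, hf⟩ : finiteDual R A)
  refine Submodule.FG.of_le (Submodule.fg_span (Set.finite_range fun i =>
    (φ i : Module.Dual R A) ∘ₗ HopfAlgebra.antipode R)) ?_
  rintro _ ⟨a, rfl⟩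
  have key : dualOrbit (f ∘ₗ HopfAlgebra.antipode R) a =
      ∑ i, f (HopfAlgebra.antipode R a * x i) •
        ((φ i : Module.Dual R A) ∘ₗ HopfAlgebra.antipode R) := by
    ext b
    simpa [HopfAlgebra.antipode_mul_antidistrib, LinearMap.sum_apply] using
      hφ () (HopfAlgebra.antipode R a) (HopfAlgebra.antipode R b)
  rw [key]
  exact Submodule.sum_mem _ fun i _ => Submodule.smul_mem _ _ (Submodule.subset_span ⟨i, rfl⟩)

/-- The antipode `f ↦ f ∘ S` of `A°` for a Hopf algebra `A` with `P_ℓ`. -/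
noncomputable def PropertyPl.antipode [HopfAlgebra R A] (h : PropertyPl R A) :
    finiteDual R A →ₗ[R] finiteDual R A :=
  (LinearMap.lcomp R R (HopfAlgebra.antipode R)).restrict fun _ hf => h.comp_antipode_mem hf

theorem PropertyPl.isAntipode_antipode [HopfAlgebra R A] (h : PropertyPl R A) :
    letI := h.coalgebra
    IsAntipode h.antipode :=
  letI := h.coalgebra
  isAntipode_of_tensorPairing (C := finiteDual R A) (B := evalPairing R A)
    (evalPairing_injective R A) (fun _ => rfl) h.exists_comul.choose_spec (fun _ => rfl)
    (fun _ _ _ => rfl) (fun _ _ => rfl)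

end FiniteDualCoalgebra

/-- Let `R` be a commutative noetherian ring and `A` an `R`-algebra with property `P_ℓ`. Then `A°`
is an `R`-coalgebra such that `(A°, A, evaluation)` is a rational pairing; if `A` is a bialgebra,
then with the convolution product `A°` is a bialgebra; if `A` is a Hopf algebra with antipode `S`,
then `A°` is a Hopf algebra with antipode `f ↦ f ∘ S`. -/
theorem mainTheorem5 (R : Type u) [CommRing R] [IsNoetherianRing R] :
    (∀ (A : Type v) [Ring A] [Algebra R A], PropertyPl R A →
      ∃ _ : Coalgebra R (finiteDual R A),
        IsRationalPairing.{u, max u v, v, w} R (finiteDual R A) A (evalPairing R A)) ∧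
    (∀ (A : Type v) [Ring A] [Bialgebra R A], PropertyPl R A →
      ∃ _ : Coalgebra R (finiteDual R A),
        IsRationalPairing.{u, max u v, v, w} R (finiteDual R A) A (evalPairing R A) ∧
        IsBialgebra R (finiteDual R A)) ∧
    (∀ (A : Type v) [Ring A] [HopfAlgebra R A], PropertyPl R A →
      ∃ _ : Coalgebra R (finiteDual R A),
        IsRationalPairing.{u, max u v, v, w} R (finiteDual R A) A (evalPairing R A) ∧
        IsBialgebra R (finiteDual R A) ∧
        ∃ S : finiteDual R A →ₗ[R] finiteDual R A,
          (∀ (f : finiteDual R A) (a : A),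
            (S f : Module.Dual R A) a = (f : Module.Dual R A) (HopfAlgebra.antipode R a)) ∧
          IsAntipode S) :=
  ⟨fun _ _ _ h => ⟨h.coalgebra, h.isRationalPairing⟩,
    fun _ _ _ h => ⟨h.coalgebra, h.isRationalPairing, h.isBialgebra_finiteDual⟩,
    fun _ _ _ h => ⟨h.coalgebra, h.isRationalPairing, h.isBialgebra_finiteDual,
      h.antipode, fun _ _ => rfl, h.isAntipode_antipode⟩⟩
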